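/- **Theorem (Fejér–Riesz inequality).** Let $\alpha,\beta>-1$ and $0<p<\infty$. Let $\mathbb D=\{z\in\mathbb C:|z|<1\}$, $\mathbb D^*=\mathbb D\setminus\{0\}$, and let $$d\mu_{\alpha,\beta}(z)=\frac{1}{\mathscr B(\alpha+1,\beta+1)}|z|^{2\beta}(1-|z|^2)^\alpha\,dA(z),\qquad dA=\frac1\pi\,dx\,dy,\qquad \mathscr B(s,t)=\frac{\Gamma(s)\Gamma(t)}{\Gamma(s+t)},$$ a measure on $\mathbb D$. Let $\mathcal A^p_{\alpha,\beta}(\mathbb D^*)$ be the set of holomorphic functions $f$ on $\mathbb D^*$ with $$\|f\|_{\alpha,\beta,p}:=\Big(\int_{\mathbb D}|f|^p\,d\mu_{\alpha,\beta}\Big)^{1/p}<\infty .$$ Let $m=m_{p,\beta}$ be $\lfloor 2(\beta+1)/p\rfloor$ if $2(\beta+1)/p\notin\mathbb N$ and $2(\beta+1)/p-1$ if $2(\beta+1)/p\in\mathbb N$, and put, for $0<r<1$, $$\mathscr J(r)=\frac{2r^{pm}}{\mathscr B(\alpha+1,\beta+1)}\int_r^1t^{2\beta-pm+1}(1-t^2)^\alpha\,dt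 .$$ Then for every $f\in\mathcal A^p_{\alpha,\beta}(\mathbb D^*)$ and every $\xi\in\mathbb C$ with $|\xi|=1$, the function $t\mapsto|f(t\xi)|^p\mathscr J(|t|)$ is integrable on $(-1,1)$ and $$\int_{-1}^1|f(t\xi)|^p\,\mathscr J(|t|)\,dt\le\pi\,\|f\|^p_{\alpha,\beta,p}.$$ -/

import Mathlib

open MeasureTheory

noncomputable section

namespace MeromorphicBergman

/-- The punctured unit disc. -/
def puncturedDisc : Set ℂ := Metric.ball 0 1 \ {0}

/-- The normalized area measure `(1/π) dx dy` on the plane. -/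
def normalizedArea : Measure ℂ := ENNReal.ofReal (1 / Real.pi) • volume

/-- The measure `|z|^(2β) (1 - |z|²)^α dA(z) / B(α+1, β+1)` on the unit disc. -/
def bergmanMeasure (α β : ℝ) : Measure ℂ :=
  (normalizedArea.restrict (Metric.ball 0 1)).withDensity fun z =>
    ENNReal.ofReal
      (1 / ProbabilityTheory.beta (α + 1) (β + 1) * ‖z‖ ^ (2 * β) * (1 - ‖z‖ ^ 2) ^ α)

/-- The functions that are holomorphic on the punctured disc and `p`-integrable for
`bergmanMeasure α β`. The values at the origin and outside the disc play no role: the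
measure does not see them. -/
def bergmanSpace (α β p : ℝ) : Set (ℂ → ℂ) :=
  {f | DifferentiableOn ℂ f puncturedDisc ∧ MemLp f (ENNReal.ofReal p) (bergmanMeasure α β)}

/-- The (quasi-)norm `(∫ |f|^p dμ)^(1/p)`. -/
def bergmanNorm (α β p : ℝ) (f : ℂ → ℂ) : ℝ :=
  (∫ z, ‖f z‖ ^ p ∂(bergmanMeasure α β)) ^ (1 / p)

open Classical in
/-- The maximal order of a pole at the origin: the integer part of `2(β+1)/p`, diminished by
one if `2(β+1)/p` is itself a natural number. -/
def maxPoleOrder (p β : ℝ) : ℕ :=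
  if ∃ n : ℕ, 2 * (β + 1) / p = n then ⌊2 * (β + 1) / p⌋₊ - 1 else ⌊2 * (β + 1) / p⌋₊

/-- The radial weight
`2 r^(pm) / B(α+1, β+1) * ∫_r^1 t^(2β - pm + 1) (1 - t²)^α dt` with `m = maxPoleOrder p β`. -/
def radialWeight (α β p r : ℝ) : ℝ :=
  2 * r ^ (p * maxPoleOrder p β) / ProbabilityTheory.beta (α + 1) (β + 1) *
    ∫ t in r..1, t ^ (2 * β - p * maxPoleOrder p β + 1) * (1 - t ^ 2) ^ α

end MeromorphicBergman

end

open MeromorphicBergman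

/-!
Put `m = maxPoleOrder p β`. The inequality is the classical Fejér–Riesz inequality
`∫_{-r}^{r} |g(tξ)|^p dt ≤ (r/2) ∫_{-π}^{π} |g(r e^{iθ})|^p dθ` for the holomorphic function
`g(z) = z^m f(z)`, integrated over `0 < r < 1` against
`(2 / B(α+1, β+1)) r^(2β-pm+1) (1-r²)^α`. Interchanging the integrals on the left produces
`|f(tξ)|^p` times the weight `radialWeight α β p |t|`, while the right-hand side is, in polar
coordinates, `π ‖f‖^p` with an additional factor `r ≤ 1` under the integral
(`setLIntegral_mul_radialWeight_le`).

The Fejér–Riesz inequality for a circle without zeros of `g` is reduced to the exponent two.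
Replacing the linear factor of `g` at each zero by the numerator of the corresponding Blaschke
factor gives a zero-free function which dominates `g` on the disc and has the same modulus on the
circle. It has a holomorphic logarithm, so there is a holomorphic `F` with `|g|^p ≤ |F|²` on the
disc and equality on the circle (`exists_sq_norm_majorant`). For `F`, the function
`z ↦ F(z) conj(F(conj z))` is holomorphic and equals `|F|²` on the real diameter; Cauchy's theorem
moves the integral to the upper half circle, where the arithmetic-geometric mean inequality
finishes the proof (`integral_diameter_sq_norm_le`). Circles containing zeros have radii in a
countable set, so they do not matter after integration over the radius.

That `z^m f(z)` is holomorphic at the origin uses the same majorant: the mean value property of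
`F²` shows that `|f|^p` has the sub-mean value property on discs for every `p > 0`
(`ofReal_mul_norm_rpow_le_setLIntegral_ball`). On the disc of radius `|z|/2` about `z` this gives
`|z|^(2(β+1)) |f(z)|^p ≤ C ∫_{|w| ≤ 3|z|/2} |f|^p dμ`, which tends to zero as `z → 0`. Since
`2(β+1) ≤ p(m+1)`, the function `z^m f(z)` is `o(1/|z|)`, and the singularity is removable
(`exists_differentiableOn_eq_pow_mul`).
-/

namespace MeromorphicBergman

open Complex Metric Set Filter Topology ComplexConjugate

/-! ### Zero-free majorants -/

/-- The Blaschke factor `R (z - u) / (R² - conj u * z)` is at most one in modulus on the closed disc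
of radius `R`. -/
theorem norm_sub_le_norm_blaschke_numerator {R : ℝ} (hR : 0 < R) {u z : ℂ} (hu : ‖u‖ ≤ R)
    (hz : ‖z‖ ≤ R) : ‖z - u‖ ≤ ‖((R : ℂ) ^ 2 - conj u * z) / R‖ := by
  have key : ‖(R : ℂ) ^ 2 - conj u * z‖ ^ 2 =
      (R * ‖z - u‖) ^ 2 + (R ^ 2 - ‖z‖ ^ 2) * (R ^ 2 - ‖u‖ ^ 2) := by
    simp only [mul_pow, Complex.sq_norm, Complex.normSq_apply]
    simp [pow_two]
    ring
  have h1 : (R * ‖z - u‖) ^ 2 ≤ ‖(R : ℂ) ^ 2 - conj u * z‖ ^ 2 := by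
    rw [key]
    have := mul_nonneg (sub_nonneg.2 (pow_le_pow_left₀ (norm_nonneg z) hz 2))
      (sub_nonneg.2 (pow_le_pow_left₀ (norm_nonneg u) hu 2))
    linarith
  rw [norm_div, le_div_iff₀ (by simpa using hR.ne'), Complex.norm_real, Real.norm_of_nonneg hR.le,
    mul_comm]
  exact le_of_sq_le_sq h1 (norm_nonneg _)

/-- The Blaschke factor `R (z - u) / (R² - conj u * z)` is unimodular on the circle of radius
`R`. -/
theorem norm_sub_eq_norm_blaschke_numerator {R : ℝ} (hR : 0 < R) {u z : ℂ}
    (hz : ‖z‖ = R) : ‖z - u‖ = ‖((R : ℂ) ^ 2 - conj u * z) / R‖ := by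
  have h : (R : ℂ) ^ 2 = conj z * z := by
    rw [← hz, ← Complex.normSq_eq_conj_mul_self, Complex.normSq_eq_norm_sq]
    push_cast
    rfl
  rw [h, ← sub_mul, ← map_sub, norm_div, norm_mul, RCLike.norm_conj, hz, Complex.norm_real,
    Real.norm_of_nonneg hR.le, mul_div_cancel_right₀ _ hR.ne']

/-- A function analytic near a closed disc, without zeros on the boundary circle, is a finite
product of linear factors, with roots in the open disc, times a zero-free function. -/
theorem exists_eq_prod_mul_of_analyticOnNhd {R : ℝ} (hR : 0 < R) {g : ℂ → ℂ}
    (hg : AnalyticOnNhd ℂ g (closedBall 0 R)) (hg0 : ∀ z ∈ sphere (0 : ℂ) R, g z ≠ 0) :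
    ∃ (S : Finset ℂ) (n : ℂ → ℕ) (k : ℂ → ℂ), (∀ u ∈ S, ‖u‖ < R) ∧
      AnalyticOnNhd ℂ k (closedBall 0 R) ∧ (∀ z ∈ closedBall (0 : ℂ) R, k z ≠ 0) ∧
      ∀ z ∈ closedBall (0 : ℂ) R, g z = (∏ u ∈ S, (z - u) ^ n u) * k z := by
  set U := closedBall (0 : ℂ) R
  have hRU : (R : ℂ) ∈ U := by simp [U, abs_of_pos hR]
  have hgR : g R ≠ 0 := hg0 R (by simp [abs_of_pos hR])
  have hUc : IsConnected U := ⟨⟨R, hRU⟩, (convex_closedBall _ _).isPreconnected⟩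
  have hord : ∀ u : U, meromorphicOrderAt g u ≠ ⊤ := by
    intro u
    refine (MeromorphicOn.exists_meromorphicOrderAt_ne_top_iff_forall hg.meromorphicOn
      hUc).1 ⟨⟨R, hRU⟩, ?_⟩ u
    rw [((hg R hRU).meromorphicNFAt.meromorphicOrderAt_eq_zero_iff).2 hgR]
    simp
  have hfin := (MeromorphicOn.divisor g U).finiteSupport (isCompact_closedBall 0 R)
  obtain ⟨k, hk, hk0, hgk⟩ := hg.meromorphicOn.extract_zeros_poles hord hfin
  set d := MeromorphicOn.divisor g U
  have hd : ∀ u, 0 ≤ d u := fun u => MeromorphicOn.AnalyticOnNhd.divisor_nonneg hg u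
  have hprod : (∏ᶠ u, (· - u) ^ d u) = fun z : ℂ => ∏ u ∈ hfin.toFinset, (z - u) ^ (d u).toNat := by
    rw [finprod_eq_prod_of_mulSupport_subset (s := hfin.toFinset)]
    · ext z
      simp only [Finset.prod_apply, Pi.pow_apply]
      refine Finset.prod_congr rfl fun u _ => ?_
      rw [← zpow_natCast, Int.toNat_of_nonneg (hd u)]
    · intro u hu
      contrapose! hu
      simp_all
  rw [hprod] at hgk
  -- The factorization holds off a discrete set, hence everywhere by continuity.
  have heq : ∀ z ∈ U, g z = (∏ u ∈ hfin.toFinset, (z - u) ^ (d u).toNat) * k z := by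
    intro z hz
    have ha : AnalyticAt ℂ ((fun z : ℂ => ∏ u ∈ hfin.toFinset, (z - u) ^ (d u).toNat) • k) z :=
      AnalyticAt.smul (by fun_prop) (hk z hz)
    have hacc : Preperfect U := by
      simp only [U]
      rw [← closure_ball _ hR.ne']
      exact isOpen_ball.perfect_closure.2
    have := (hg z hz).meromorphicAt.eventuallyEq_nhdsNE_of_eventuallyEq_codiscreteWithin_preperfect
      ha.meromorphicAt hz hacc hgk
    rw [ContinuousAt.eventuallyEq_nhds_iff_eventuallyEq_nhdsNE (hg z hz).continuousAt
      ha.continuousAt] at this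
    exact this.eq_of_nhds
  refine ⟨hfin.toFinset, fun u => (d u).toNat, k, fun u hu => ?_, hk, fun z hz => hk0 ⟨z, hz⟩, heq⟩
  have hdu : d u ≠ 0 := by simpa using hu
  have huU : u ∈ U := d.supportWithinDomain hdu
  refine lt_of_le_of_ne (by simpa [U] using huU) fun hne => hg0 u (by simpa using hne) ?_
  rw [heq u huU, Finset.prod_eq_zero hu, zero_mul]
  rw [sub_self, zero_pow]
  have := hd u
  omega

/-- Replacing the linear factors at the zeros by the numerators of the Blaschke factors gives
a zero-free majorant with the same modulus on the boundary circle. -/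
theorem exists_zeroFree_majorant {R : ℝ} (hR : 0 < R) {g : ℂ → ℂ}
    (hg : AnalyticOnNhd ℂ g (closedBall 0 R)) (hg0 : ∀ z ∈ sphere (0 : ℂ) R, g z ≠ 0) :
    ∃ h : ℂ → ℂ, AnalyticOnNhd ℂ h (closedBall 0 R) ∧ (∀ z ∈ closedBall (0 : ℂ) R, h z ≠ 0) ∧
      (∀ z ∈ closedBall (0 : ℂ) R, ‖g z‖ ≤ ‖h z‖) ∧ ∀ z ∈ sphere (0 : ℂ) R, ‖g z‖ = ‖h z‖ := by
  obtain ⟨S, n, k, hS, hk, hk0, hgk⟩ := exists_eq_prod_mul_of_analyticOnNhd hR hg hg0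
  have hRC : (R : ℂ) ≠ 0 := by exact_mod_cast hR.ne'
  refine ⟨fun z => (∏ u ∈ S, (((R : ℂ) ^ 2 - conj u * z) / R) ^ n u) * k z, ?_, ?_, ?_, ?_⟩
  · intro z hz
    refine AnalyticAt.mul ?_ (hk z hz)
    refine Finset.analyticAt_fun_prod _ fun u _ => ?_
    refine AnalyticAt.pow ?_ _
    exact (analyticAt_const.sub (analyticAt_const.mul analyticAt_id)).div analyticAt_const hRC
  · intro z hz
    refine mul_ne_zero (Finset.prod_ne_zero_iff.2 fun u hu => pow_ne_zero _ ?_) (hk0 z hz)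
    refine div_ne_zero (sub_ne_zero.2 fun h => ?_) hRC
    have h' := congrArg norm h
    rw [norm_mul, RCLike.norm_conj, norm_pow, Complex.norm_real, Real.norm_of_nonneg hR.le] at h'
    have hz' : ‖z‖ ≤ R := by simpa using hz
    have := hS u hu
    nlinarith [norm_nonneg u, norm_nonneg z]
  · intro z hz
    have hz' : ‖z‖ ≤ R := by simpa using hz
    rw [hgk z hz, norm_mul, norm_mul, norm_prod, norm_prod]
    refine mul_le_mul_of_nonneg_right (Finset.prod_le_prod (fun _ _ => norm_nonneg _)
      fun u hu => ?_) (norm_nonneg _)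
    rw [norm_pow, norm_pow]
    exact pow_le_pow_left₀ (norm_nonneg _)
      (norm_sub_le_norm_blaschke_numerator hR (hS u hu).le hz') _
  · intro z hz
    have hz' : ‖z‖ = R := by simpa using hz
    rw [hgk z (sphere_subset_closedBall hz), norm_mul, norm_mul, norm_prod, norm_prod]
    congr 1
    refine Finset.prod_congr rfl fun u _ => ?_
    rw [norm_pow, norm_pow, norm_sub_eq_norm_blaschke_numerator hR hz']

/-- A zero-free holomorphic function on a disc has a holomorphic logarithm. -/
theorem exists_log_of_differentiableOn_ball {c : ℂ} {R : ℝ} {h : ℂ → ℂ}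
    (hh : DifferentiableOn ℂ h (ball c R)) (h0 : ∀ z ∈ ball c R, h z ≠ 0) :
    ∃ L : ℂ → ℂ, DifferentiableOn ℂ L (ball c R) ∧ ∀ z ∈ ball c R, Complex.exp (L z) = h z := by
  rcases le_or_gt R 0 with hR | hR
  · exact ⟨0, by simp [ball_eq_empty.2 hR]⟩
  have hc : c ∈ ball c R := mem_ball_self hR
  have hd : DifferentiableOn ℂ (fun z => deriv h z / h z) (ball c R) :=
    (hh.deriv isOpen_ball).div hh h0
  obtain ⟨L, hLc, hL⟩ := hd.isExactOn_ball.with_val_at c (Complex.log (h c))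
  have hLd : DifferentiableOn ℂ L (ball c R) :=
    fun z hz => (hL z hz).differentiableAt.differentiableWithinAt
  refine ⟨L, hLd, ?_⟩
  -- The quotient `exp L / h` has derivative zero and value one at the centre.
  have hder : ∀ z ∈ ball c R, HasDerivAt (fun z => Complex.exp (L z) / h z) 0 z := by
    intro z hz
    have h1 := (hh.differentiableAt (isOpen_ball.mem_nhds hz)).hasDerivAt
    have := (hL z hz).cexp.div h1 (h0 z hz)
    rw [mul_assoc, div_mul_cancel₀ _ (h0 z hz), sub_self, zero_div] at this
    exact this
  intro z hz
  have hconst := (convex_ball c R).is_const_of_fderivWithin_eq_zero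
    (f := fun z => Complex.exp (L z) / h z) (𝕜 := ℂ)
    (fun z hz => (hder z hz).differentiableAt.differentiableWithinAt)
    (fun z hz => by
      rw [fderivWithin_of_isOpen isOpen_ball hz]
      ext
      simp [(hder z hz).deriv]) hz hc
  simp only [hLc, Complex.exp_log (h0 c hc), div_self (h0 c hc)] at hconst
  rwa [div_eq_one_iff_eq (h0 z hz)] at hconst

/-- For every exponent `q > 0`, the function `|g|^q` is dominated on the disc by the squared
modulus of a holomorphic function, with equality on the boundary circle. -/
theorem exists_sq_norm_majorant {R : ℝ} (hR : 0 < R) {g : ℂ → ℂ}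
    (hg : AnalyticOnNhd ℂ g (closedBall 0 R)) (hg0 : ∀ z ∈ sphere (0 : ℂ) R, g z ≠ 0)
    {q : ℝ} (hq : 0 < q) :
    ∃ R' > R, ∃ F : ℂ → ℂ, DifferentiableOn ℂ F (ball 0 R') ∧
      (∀ z ∈ closedBall (0 : ℂ) R, ‖g z‖ ^ q ≤ ‖F z‖ ^ 2) ∧
      ∀ z ∈ sphere (0 : ℂ) R, ‖g z‖ ^ q = ‖F z‖ ^ 2 := by
  obtain ⟨h, hh, hh0, hle, heq⟩ := exists_zeroFree_majorant hR hg hg0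
  -- By compactness, `h` is still analytic and zero-free on a slightly larger disc.
  have hopen : IsOpen {z | AnalyticAt ℂ h z ∧ h z ≠ 0} := by
    rw [isOpen_iff_mem_nhds]
    rintro z ⟨hz, hz0⟩
    exact hz.eventually_analyticAt.and (hz.continuousAt.eventually_ne hz0)
  obtain ⟨δ, hδ, hsub⟩ := (isCompact_closedBall (0 : ℂ) R).exists_thickening_subset_open hopen
    fun z hz => ⟨hh z hz, hh0 z hz⟩
  rw [thickening_closedBall hδ hR.le] at hsub
  obtain ⟨L, hL, hLh⟩ := exists_log_of_differentiableOn_ball (h := h) (c := 0) (R := δ + R)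
    (fun z hz => (hsub hz).1.differentiableAt.differentiableWithinAt) (fun z hz => (hsub hz).2)
  have hRR' : R < δ + R := by linarith
  have hF : ∀ z ∈ closedBall (0 : ℂ) R, ‖Complex.exp (q / 2 * L z)‖ ^ 2 = ‖h z‖ ^ q := by
    intro z hz
    rw [← hLh z (closedBall_subset_ball hRR' hz), Complex.norm_exp, Complex.norm_exp,
      ← Real.exp_mul, ← Real.exp_nat_mul]
    congr 1
    have : ((q : ℂ) / 2 * L z).re = q / 2 * (L z).re := by
      rw [show (q : ℂ) / 2 = ((q / 2 : ℝ) : ℂ) by push_cast; rfl, Complex.re_ofReal_mul]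
    rw [this]
    push_cast
    ring
  refine ⟨δ + R, hRR', fun z => Complex.exp (q / 2 * L z), (hL.const_mul _).cexp, ?_, ?_⟩
  · intro z hz
    rw [hF z hz]
    exact Real.rpow_le_rpow (norm_nonneg _) (hle z hz) hq.le
  · intro z hz
    rw [hF z (sphere_subset_closedBall hz), heq z hz]

/-! ### The Fejér–Riesz inequality and the sub-mean value property on circles -/

theorem circleMap_mem_closedBall_zero {R : ℝ} (hR : 0 ≤ R) (θ : ℝ) :
    circleMap 0 R θ ∈ closedBall (0 : ℂ) R := circleMap_mem_closedBall 0 hR θ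

theorem conj_circleMap_zero (R θ : ℝ) : conj (circleMap 0 R θ) = circleMap 0 R (-θ) := by
  simp [circleMap, ← Complex.exp_conj]

theorem intervalIntegrable_comp_circleMap {R : ℝ} (hR : 0 ≤ R) {u : ℂ → ℝ}
    (hu : ContinuousOn u (closedBall 0 R)) (a b : ℝ) :
    IntervalIntegrable (fun θ => u (circleMap 0 R θ)) volume a b :=
  (hu.comp_continuous (continuous_circleMap 0 R)
    (circleMap_mem_closedBall_zero hR)).intervalIntegrable _ _

theorem intervalIntegrable_comp_ofReal {R : ℝ} (hR : 0 ≤ R) {u : ℂ → ℝ}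
    (hu : ContinuousOn u (closedBall 0 R)) :
    IntervalIntegrable (fun x : ℝ => u x) volume (-R) R := by
  refine ContinuousOn.intervalIntegrable
    (hu.comp Complex.continuous_ofReal.continuousOn fun x hx => ?_)
  rw [uIcc_of_le (by linarith)] at hx
  simpa using abs_le.2 hx

/-- The quadratic case: `|F|²` equals on the diameter the holomorphic function
`z ↦ F(z) * conj (F (conj z))`, whose integral over the diameter can be moved to the upper
half circle. -/
theorem integral_diameter_sq_norm_le {R R' : ℝ} (hR : 0 < R) (hRR' : R < R') {F : ℂ → ℂ}
    (hF : DifferentiableOn ℂ F (ball 0 R')) :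
    ∫ x in (-R)..R, ‖F x‖ ^ 2 ≤ R / 2 * ∫ θ in (-Real.pi)..Real.pi, ‖F (circleMap 0 R θ)‖ ^ 2 := by
  have hconj : ∀ z ∈ ball (0 : ℂ) R', conj z ∈ ball (0 : ℂ) R' := fun z hz => by simpa using hz
  have hG : DifferentiableOn ℂ (fun z => F z * conj (F (conj z))) (ball 0 R') := by
    intro z hz
    have h1 := hF.differentiableAt (isOpen_ball.mem_nhds hz)
    have h2 := (hF.differentiableAt (isOpen_ball.mem_nhds (hconj z hz))).conj_conj
    rw [Complex.conj_conj] at h2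
    exact (h1.mul h2).differentiableWithinAt
  obtain ⟨Φ, hΦ⟩ := hG.isExactOn_ball
  have hsub : closedBall (0 : ℂ) R ⊆ ball 0 R' := closedBall_subset_ball hRR'
  have hGc := (hG.mono hsub).continuousOn
  have hFc : ContinuousOn (fun z => ‖F z‖ ^ 2) (closedBall 0 R) :=
    ((hF.mono hsub).continuousOn.norm).pow 2
  have hcirc := circleMap_mem_closedBall_zero hR.le
  have hdiam : ∀ x ∈ uIcc (-R) R, (x : ℂ) ∈ closedBall (0 : ℂ) R := by
    intro x hx
    rw [uIcc_of_le (by linarith)] at hx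
    simpa using abs_le.2 hx
  have hI1 : ∫ x in (-R)..R, F x * conj (F (conj (x : ℂ))) = Φ R - Φ (-R : ℝ) :=
    intervalIntegral.integral_eq_sub_of_hasDerivAt
      (fun x hx => (hΦ x (hsub (hdiam x hx))).comp_ofReal)
      (ContinuousOn.intervalIntegrable
        (hGc.comp Complex.continuous_ofReal.continuousOn hdiam))
  have hI2 : ∫ θ in (0 : ℝ)..Real.pi, F (circleMap 0 R θ) * conj (F (conj (circleMap 0 R θ))) *
      (circleMap 0 R θ * I) = Φ (-R : ℝ) - Φ R := by
    have := intervalIntegral.integral_eq_sub_of_hasDerivAt (a := 0) (b := Real.pi)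
      (f := fun θ : ℝ => Φ (circleMap 0 R θ))
      (fun θ _ => (hΦ _ (hsub (hcirc θ))).comp θ (hasDerivAt_circleMap 0 R θ))
      (by
        refine Continuous.intervalIntegrable ?_ _ _
        exact (hGc.comp_continuous (continuous_circleMap 0 R) hcirc).mul
          ((continuous_circleMap 0 R).mul continuous_const))
    simpa [circleMap] using this
  have hcpos : IntervalIntegrable (fun θ => ‖F (circleMap 0 R θ)‖ ^ 2) volume 0 Real.pi :=
    intervalIntegrable_comp_circleMap hR.le hFc _ _
  have hcneg : IntervalIntegrable (fun θ => ‖F (circleMap 0 R (-θ))‖ ^ 2) volume 0 Real.pi := by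
    refine Continuous.intervalIntegrable ?_ _ _
    exact hFc.comp_continuous ((continuous_circleMap 0 R).comp continuous_neg) fun θ => hcirc _
  calc ∫ x in (-R)..R, ‖F x‖ ^ 2
      = ‖∫ x in (-R)..R, F x * conj (F (conj (x : ℂ)))‖ := by
        have : ∀ x : ℝ, F x * conj (F (conj (x : ℂ))) = ((‖F x‖ ^ 2 : ℝ) : ℂ) := fun x => by
          rw [Complex.conj_ofReal, Complex.mul_conj, Complex.normSq_eq_norm_sq]
        simp_rw [this]
        rw [intervalIntegral.integral_ofReal, Complex.norm_real, Real.norm_of_nonneg]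
        exact intervalIntegral.integral_nonneg (by linarith) fun x _ => sq_nonneg _
    _ = ‖∫ θ in (0 : ℝ)..Real.pi, F (circleMap 0 R θ) * conj (F (conj (circleMap 0 R θ))) *
          (circleMap 0 R θ * I)‖ := by
        rw [hI1, hI2, norm_sub_rev]
    _ ≤ ∫ θ in (0 : ℝ)..Real.pi,
          R / 2 * (‖F (circleMap 0 R θ)‖ ^ 2 + ‖F (circleMap 0 R (-θ))‖ ^ 2) := by
        refine intervalIntegral.norm_integral_le_of_norm_le Real.pi_pos.le
          (ae_of_all _ fun θ _ => ?_) ((hcpos.add hcneg).const_mul _)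
        rw [conj_circleMap_zero, norm_mul, norm_mul, norm_mul, RCLike.norm_conj, norm_circleMap_zero,
          abs_of_pos hR, Complex.norm_I, mul_one]
        have := two_mul_le_add_sq ‖F (circleMap 0 R θ)‖ ‖F (circleMap 0 R (-θ))‖
        nlinarith
    _ = R / 2 * ∫ θ in (-Real.pi)..Real.pi, ‖F (circleMap 0 R θ)‖ ^ 2 := by
        rw [intervalIntegral.integral_const_mul, intervalIntegral.integral_add hcpos hcneg,
          intervalIntegral.integral_comp_neg fun θ => ‖F (circleMap 0 R θ)‖ ^ 2, neg_zero, add_comm,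
          intervalIntegral.integral_add_adjacent_intervals
            (intervalIntegrable_comp_circleMap hR.le hFc _ _) hcpos]

/-- The Fejér–Riesz inequality for an arbitrary exponent, on a circle free of zeros. -/
theorem integral_diameter_norm_rpow_le {R : ℝ} (hR : 0 < R) {g : ℂ → ℂ}
    (hg : AnalyticOnNhd ℂ g (closedBall 0 R)) (hg0 : ∀ z ∈ sphere (0 : ℂ) R, g z ≠ 0)
    {q : ℝ} (hq : 0 < q) :
    ∫ x in (-R)..R, ‖g x‖ ^ q ≤ R / 2 * ∫ θ in (-Real.pi)..Real.pi, ‖g (circleMap 0 R θ)‖ ^ q := by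
  obtain ⟨R', hRR', F, hF, hle, heq⟩ := exists_sq_norm_majorant hR hg hg0 hq
  have hFc : ContinuousOn (fun z => ‖F z‖ ^ 2) (closedBall 0 R) :=
    ((hF.mono (closedBall_subset_ball hRR')).continuousOn.norm).pow 2
  have hgc : ContinuousOn (fun z => ‖g z‖ ^ q) (closedBall 0 R) :=
    hg.continuousOn.norm.rpow_const fun _ _ => Or.inr hq.le
  have h := integral_diameter_sq_norm_le hR hRR' hF
  calc ∫ x in (-R)..R, ‖g x‖ ^ q ≤ ∫ x in (-R)..R, ‖F x‖ ^ 2 := by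
        refine intervalIntegral.integral_mono_on (by linarith)
          (intervalIntegrable_comp_ofReal hR.le hgc)
          (intervalIntegrable_comp_ofReal hR.le hFc) fun x hx => hle x ?_
        simpa using abs_le.2 hx
    _ ≤ R / 2 * ∫ θ in (-Real.pi)..Real.pi, ‖F (circleMap 0 R θ)‖ ^ 2 := h
    _ = _ := by
        congr 2
        ext θ
        exact (heq _ (circleMap_mem_sphere 0 hR.le θ)).symm

/-- The sub-mean value property of `|g|^q`, on a circle free of zeros. -/
theorem norm_rpow_le_integral_circle {R : ℝ} (hR : 0 < R) {g : ℂ → ℂ}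
    (hg : AnalyticOnNhd ℂ g (closedBall 0 R)) (hg0 : ∀ z ∈ sphere (0 : ℂ) R, g z ≠ 0)
    {q : ℝ} (hq : 0 < q) :
    2 * Real.pi * ‖g 0‖ ^ q ≤ ∫ θ in (-Real.pi)..Real.pi, ‖g (circleMap 0 R θ)‖ ^ q := by
  obtain ⟨R', hRR', F, hF, hle, heq⟩ := exists_sq_norm_majorant hR hg hg0 hq
  have hmean : Real.circleAverage (fun z => F z ^ 2) 0 R = F 0 ^ 2 := by
    refine DiffContOnCl.circleAverage (f := fun z => F z ^ 2) ?_
    rw [abs_of_pos hR]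
    refine DifferentiableOn.diffContOnCl_ball (U := ball 0 R') (hF.pow 2) ?_
    exact closedBall_subset_ball hRR'
  have hper : ∫ θ in (-Real.pi)..Real.pi, ‖F (circleMap 0 R θ)‖ ^ 2 =
      ∫ θ in (0 : ℝ)..2 * Real.pi, ‖F (circleMap 0 R θ)‖ ^ 2 := by
    have hp : Function.Periodic (fun θ => ‖F (circleMap 0 R θ)‖ ^ 2) (2 * Real.pi) := fun θ => by
      simp only [periodic_circleMap 0 R θ]
    have := hp.intervalIntegral_add_eq (-Real.pi) 0
    rwa [show -Real.pi + 2 * Real.pi = Real.pi by ring, zero_add] at this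
  calc 2 * Real.pi * ‖g 0‖ ^ q ≤ 2 * Real.pi * ‖F 0 ^ 2‖ := by
        rw [norm_pow]
        exact mul_le_mul_of_nonneg_left (hle 0 (by simp [hR.le])) Real.two_pi_pos.le
    _ = ‖∫ θ in (0 : ℝ)..2 * Real.pi, F (circleMap 0 R θ) ^ 2‖ := by
        rw [← hmean, Real.circleAverage_def, norm_smul, norm_inv, Real.norm_of_nonneg
          Real.two_pi_pos.le, mul_inv_cancel_left₀ Real.two_pi_pos.ne']
    _ ≤ ∫ θ in (0 : ℝ)..2 * Real.pi, ‖F (circleMap 0 R θ) ^ 2‖ :=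
        intervalIntegral.norm_integral_le_integral_norm Real.two_pi_pos.le
    _ = ∫ θ in (-Real.pi)..Real.pi, ‖F (circleMap 0 R θ)‖ ^ 2 := by
        simp_rw [hper, norm_pow]
    _ = _ := by
        congr 1
        ext θ
        exact (heq _ (circleMap_mem_sphere 0 hR.le θ)).symm

/-- A holomorphic function on a disc that does not vanish identically has only countably many
zeros, so almost every circle about the origin is free of them. -/
theorem eqOn_zero_or_ae_radius_ne_zero {R : ℝ} {g : ℂ → ℂ} (hg : DifferentiableOn ℂ g (ball 0 R)) :
    (∀ z ∈ ball (0 : ℂ) R, g z = 0) ∨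
      ∀ᵐ r : ℝ, 0 < r → r < R → ∀ z ∈ sphere (0 : ℂ) r, g z ≠ 0 := by
  rw [or_iff_not_imp_left]
  intro hne
  push Not at hne
  obtain ⟨w, hw, hgw⟩ := hne
  have hcod := (hg.analyticOnNhd isOpen_ball).preimage_zero_mem_codiscreteWithin hgw hw
    ⟨⟨w, hw⟩, (convex_ball _ _).isPreconnected⟩
  have hdisc : IsDiscrete (g ⁻¹' {0} ∩ ball 0 R) := isDiscrete_of_codiscreteWithin hcod
  have hcount : (g ⁻¹' {0} ∩ ball 0 R).Countable := by
    have := hdisc.to_subtype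
    exact countable_coe_iff.1 (TopologicalSpace.separableSpace_iff_countable.1 inferInstance)
  have hae := (hcount.image norm).ae_notMem (volume : Measure ℝ)
  filter_upwards [hae] with r hr _ hrR z hz hgz
  have hzr : ‖z‖ = r := by simpa using hz
  exact hr ⟨z, ⟨hgz, by simpa [hzr] using hrR⟩, hzr⟩

/-! ### Arbitrary diameters, discs, and lower integrals -/

theorem mul_circleMap_zero_eq {ξ : ℂ} (hξ : ‖ξ‖ = 1) (R θ : ℝ) :
    circleMap 0 R θ * ξ = circleMap 0 R (θ + arg ξ) := by
  have h : ξ = Complex.exp (arg ξ * I) := by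
    have := norm_mul_exp_arg_mul_I ξ
    rwa [hξ, ofReal_one, one_mul, eq_comm] at this
  conv_lhs => rw [h]
  simp [circleMap, add_mul, Complex.exp_add, mul_assoc]

/-- The Fejér–Riesz inequality along an arbitrary diameter, on a circle free of zeros. -/
theorem integral_rotated_diameter_norm_rpow_le {R : ℝ} (hR : 0 < R) {g : ℂ → ℂ}
    (hg : AnalyticOnNhd ℂ g (closedBall 0 R)) (hg0 : ∀ z ∈ sphere (0 : ℂ) R, g z ≠ 0)
    {q : ℝ} (hq : 0 < q) {ξ : ℂ} (hξ : ‖ξ‖ = 1) :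
    ∫ x in (-R)..R, ‖g (x * ξ)‖ ^ q ≤
      R / 2 * ∫ θ in (-Real.pi)..Real.pi, ‖g (circleMap 0 R θ)‖ ^ q := by
  have h := integral_diameter_norm_rpow_le hR (g := fun z => g (z * ξ))
    (fun z hz => AnalyticAt.fun_comp (f := fun z => z * ξ) (x := z)
      (hg (z * ξ) (by simpa [hξ] using hz)) (by fun_prop))
    (fun z hz => hg0 (z * ξ) (by simpa [hξ] using hz)) hq
  refine h.trans_eq ?_
  simp_rw [mul_circleMap_zero_eq hξ]
  congr 1
  have hp : Function.Periodic (fun θ => ‖g (circleMap 0 R θ)‖ ^ q) (2 * Real.pi) := fun θ => by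
    simp only [periodic_circleMap 0 R θ]
  rw [intervalIntegral.integral_comp_add_right (fun θ => ‖g (circleMap 0 R θ)‖ ^ q)]
  have := hp.intervalIntegral_add_eq (-Real.pi + arg ξ) (-Real.pi)
  rwa [show -Real.pi + arg ξ + 2 * Real.pi = Real.pi + arg ξ by ring,
    show -Real.pi + 2 * Real.pi = Real.pi by ring] at this

theorem lintegral_Ioo_ofReal_eq {a b : ℝ} (hab : a ≤ b) {u : ℝ → ℝ} (hu0 : ∀ x, 0 ≤ u x)
    (hu : IntervalIntegrable u volume a b) :
    ∫⁻ x in Ioo a b, ENNReal.ofReal (u x) = ENNReal.ofReal (∫ x in a..b, u x) := by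
  rw [intervalIntegral.integral_of_le hab, integral_Ioc_eq_integral_Ioo,
    ofReal_integral_eq_lintegral_ofReal
      ((hu.1).mono_set Ioo_subset_Ioc_self) (ae_of_all _ hu0)]

/-- Polar coordinates on a disc. Continuity off the centre suffices, so that the formula applies to
functions with a singularity there; it is used only for measurability. -/
theorem setLIntegral_ball_eq_polar {R : ℝ} {u : ℂ → ℝ} (hu : ContinuousOn u (ball 0 R \ {0})) :
    ∫⁻ z in ball 0 R, ENNReal.ofReal (u z) =
      ∫⁻ r in Ioo 0 R, ENNReal.ofReal r *
        ∫⁻ θ in Ioo (-Real.pi) Real.pi, ENNReal.ofReal (u (circleMap 0 r θ)) := by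
  classical
  set s : Set ℂ := ball 0 R \ {0}
  have hs : IsOpen s := isOpen_ball.sdiff isClosed_singleton
  set v : ℂ → ENNReal := fun z => ENNReal.ofReal (s.piecewise u 0 z)
  have hv : Measurable v :=
    ENNReal.measurable_ofReal.comp
      (hu.measurable_piecewise continuousOn_const hs.measurableSet)
  have hvs : v = s.indicator fun z => ENNReal.ofReal (u z) := by
    ext z
    by_cases hz : z ∈ s <;> simp [v, hz]
  have h1 : ∫⁻ z in ball 0 R, ENNReal.ofReal (u z) = ∫⁻ z, v z := by
    rw [hvs, lintegral_indicator hs.measurableSet]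
    refine setLIntegral_congr ?_
    exact (sdiff_null_ae_eq_self (measure_singleton 0)).symm
  have hpol : ∀ x : ℝ × ℝ, Complex.polarCoord.symm x = circleMap 0 x.1 x.2 := fun x => by
    simp [circleMap, Complex.exp_mul_I]
  rw [h1, ← Complex.lintegral_comp_polarCoord_symm]
  simp_rw [hpol, smul_eq_mul]
  have hmeas : Measurable fun x : ℝ × ℝ => ENNReal.ofReal x.1 * v (circleMap 0 x.1 x.2) := by
    refine (ENNReal.measurable_ofReal.comp measurable_fst).mul (hv.comp ?_)
    have : Continuous fun x : ℝ × ℝ => circleMap 0 x.1 x.2 := by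
      unfold circleMap
      fun_prop
    exact this.measurable
  rw [show polarCoord.target = Ioi (0 : ℝ) ×ˢ Ioo (-Real.pi) Real.pi from rfl,
    Measure.volume_eq_prod, ← Measure.prod_restrict, lintegral_prod _ hmeas.aemeasurable]
  have h2 : ∀ r ∈ Ioi (0 : ℝ), ∫⁻ θ in Ioo (-Real.pi) Real.pi,
      ENNReal.ofReal r * v (circleMap 0 r θ) = (Ioo 0 R).indicator (fun r => ENNReal.ofReal r *
        ∫⁻ θ in Ioo (-Real.pi) Real.pi, ENNReal.ofReal (u (circleMap 0 r θ))) r := by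
    intro r hr
    have hr' : (0 : ℝ) < r := hr
    have hmem : ∀ θ, circleMap 0 r θ ∈ s ↔ r < R := fun θ => by
      simp [s, abs_of_pos hr', hr'.ne']
    rw [lintegral_const_mul' _ _ ENNReal.ofReal_ne_top]
    by_cases hrR : r < R
    · rw [indicator_of_mem (show r ∈ Ioo 0 R from ⟨hr', hrR⟩)]
      simp [hvs, hmem, hrR]
    · rw [indicator_of_notMem (fun h => hrR h.2)]
      simp [hvs, hmem, hrR]
  rw [setLIntegral_congr_fun measurableSet_Ioi h2, setLIntegral_indicator measurableSet_Ioo]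
  congr 2
  ext r
  simp +contextual

/-- The sub-mean value property of `|g|^q` over a disc, for every `q > 0`. -/
theorem ofReal_mul_norm_rpow_le_setLIntegral_ball {c : ℂ} {R : ℝ} (hR : 0 < R) {g : ℂ → ℂ}
    (hg : DifferentiableOn ℂ g (ball c R)) {q : ℝ} (hq : 0 < q) :
    ENNReal.ofReal (Real.pi * R ^ 2 * ‖g c‖ ^ q) ≤ ∫⁻ z in ball c R, ENNReal.ofReal (‖g z‖ ^ q) := by
  set k : ℂ → ℂ := fun z => g (c + z)
  have hk : DifferentiableOn ℂ k (ball 0 R) := by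
    refine hg.comp ((differentiable_const c).add differentiable_id).differentiableOn fun z hz => ?_
    simpa using hz
  have htrans : ∫⁻ z in ball c R, ENNReal.ofReal (‖g z‖ ^ q) =
      ∫⁻ z in ball 0 R, ENNReal.ofReal (‖k z‖ ^ q) := by
    rw [← lintegral_indicator measurableSet_ball, ← lintegral_indicator measurableSet_ball,
      ← lintegral_add_left_eq_self _ c]
    congr 1
    ext z
    simp [indicator, k]
  have hkc : k 0 = g c := by simp [k]
  have hu : ContinuousOn (fun z => ‖k z‖ ^ q) (ball 0 R) :=
    hk.continuousOn.norm.rpow_const fun _ _ => Or.inr hq.le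
  rw [htrans, setLIntegral_ball_eq_polar (hu.mono sdiff_subset), ← hkc]
  rcases eqOn_zero_or_ae_radius_ne_zero hk with h0 | h0
  · rw [h0 0 (mem_ball_self hR)]
    simp [Real.zero_rpow hq.ne']
  calc ENNReal.ofReal (Real.pi * R ^ 2 * ‖k 0‖ ^ q)
      = ∫⁻ r in Ioo 0 R, ENNReal.ofReal r * ENNReal.ofReal (2 * Real.pi * ‖k 0‖ ^ q) := by
        have hpos : (0 : ℝ) ≤ 2 * Real.pi * ‖k 0‖ ^ q := by positivity
        have hid : ∫⁻ r in Ioo 0 R, ENNReal.ofReal r = ENNReal.ofReal (R ^ 2 / 2) := by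
          rw [setLIntegral_congr_fun measurableSet_Ioo
            (g := fun r => ENNReal.ofReal |r|) (fun r hr => by simp only [abs_of_pos hr.1]),
            lintegral_Ioo_ofReal_eq hR.le (fun x => abs_nonneg x)
              (continuous_abs.intervalIntegrable _ _),
            intervalIntegral.integral_congr (g := fun x => x) fun x hx => ?_, integral_id]
          · simp
          · rw [uIcc_of_le hR.le] at hx
            exact abs_of_nonneg hx.1
        rw [lintegral_mul_const' _ _ ENNReal.ofReal_ne_top, hid, ← ENNReal.ofReal_mul (by positivity)]
        congr 1
        ring
    _ ≤ _ := by
        refine lintegral_mono_ae ?_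
        filter_upwards [ae_restrict_of_ae h0, ae_restrict_mem measurableSet_Ioo] with r hr hrR
        have hsub : closedBall (0 : ℂ) r ⊆ ball 0 R := closedBall_subset_ball hrR.2
        have hint := norm_rpow_le_integral_circle hrR.1
          ((hk.analyticOnNhd isOpen_ball).mono hsub) (hr hrR.1 hrR.2) hq
        rw [lintegral_Ioo_ofReal_eq (u := fun θ => ‖k (circleMap 0 r θ)‖ ^ q)
          (by linarith [Real.pi_pos]) (fun θ => by positivity)
          (intervalIntegrable_comp_circleMap hrR.1.le (hu.mono hsub) _ _)]
        gcongr

/-- The Fejér–Riesz inequality as an inequality of lower integrals, on almost every circle. -/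
theorem ae_setLIntegral_diameter_le {R : ℝ} {g : ℂ → ℂ} (hg : DifferentiableOn ℂ g (ball 0 R))
    {q : ℝ} (hq : 0 < q) {ξ : ℂ} (hξ : ‖ξ‖ = 1) :
    ∀ᵐ r : ℝ, 0 < r → r < R →
      ∫⁻ x in Ioo (-r) r, ENNReal.ofReal (‖g (x * ξ)‖ ^ q) ≤ ENNReal.ofReal (r / 2) *
        ∫⁻ θ in Ioo (-Real.pi) Real.pi, ENNReal.ofReal (‖g (circleMap 0 r θ)‖ ^ q) := by
  have hmemξ : ∀ {r x : ℝ}, |x| ≤ r → (x : ℂ) * ξ ∈ closedBall (0 : ℂ) r := fun h => by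
    simpa [hξ] using h
  rcases eqOn_zero_or_ae_radius_ne_zero hg with h0 | h0
  · refine ae_of_all _ fun r hr hrR => ?_
    rw [setLIntegral_congr_fun (g := fun _ => 0) measurableSet_Ioo fun x hx => ?_]
    · simp
    · simp only
      rw [h0 _ (closedBall_subset_ball hrR (hmemξ (abs_le.2 ⟨hx.1.le, hx.2.le⟩)))]
      simp [Real.zero_rpow hq.ne']
  filter_upwards [h0] with r hr0 hr hrR
  have hsub : closedBall (0 : ℂ) r ⊆ ball 0 R := closedBall_subset_ball hrR
  have hu : ContinuousOn (fun z => ‖g z‖ ^ q) (closedBall 0 r) :=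
    (hg.mono hsub).continuousOn.norm.rpow_const fun _ _ => Or.inr hq.le
  have hint := integral_rotated_diameter_norm_rpow_le hr
    ((hg.analyticOnNhd isOpen_ball).mono hsub) (hr0 hr hrR) hq hξ
  rw [lintegral_Ioo_ofReal_eq (u := fun θ => ‖g (circleMap 0 r θ)‖ ^ q)
      (by linarith [Real.pi_pos]) (fun θ => by positivity)
      (intervalIntegrable_comp_circleMap hr.le hu _ _),
    lintegral_Ioo_ofReal_eq (u := fun x : ℝ => ‖g (x * ξ)‖ ^ q)
      (by linarith) (fun θ => by positivity), ← ENNReal.ofReal_mul (by positivity)]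
  · exact ENNReal.ofReal_le_ofReal hint
  · refine intervalIntegrable_comp_ofReal hr.le (u := fun z => ‖g (z * ξ)‖ ^ q)
      (hu.comp (continuous_mul_const ξ).continuousOn fun z hz => ?_)
    simpa [hξ] using hz

/-! ### The singularity at the puncture -/

theorem beta_add_one_pos {α β : ℝ} (hα : -1 < α) (hβ : -1 < β) :
    0 < ProbabilityTheory.beta (α + 1) (β + 1) :=
  ProbabilityTheory.beta_pos (by linarith) (by linarith)

/-- The density of `bergmanMeasure α β` as a function of the modulus. -/
noncomputable def radialDensity (α β r : ℝ) : ℝ :=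
  1 / ProbabilityTheory.beta (α + 1) (β + 1) * r ^ (2 * β) * (1 - r ^ 2) ^ α

theorem radialDensity_nonneg {α β : ℝ} (hα : -1 < α) (hβ : -1 < β) {r : ℝ} (h0 : 0 ≤ r)
    (h1 : r ≤ 1) : 0 ≤ radialDensity α β r := by
  have := beta_add_one_pos hα hβ
  have h2 : 0 ≤ 1 - r ^ 2 := by nlinarith
  unfold radialDensity
  positivity

theorem setLIntegral_bergmanMeasure {α β : ℝ} (hα : -1 < α) (hβ : -1 < β) {S : Set ℂ}
    (hS : MeasurableSet S) (v : ℂ → ℝ) :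
    ∫⁻ z in S, ENNReal.ofReal (v z) ∂bergmanMeasure α β =
      ENNReal.ofReal (1 / Real.pi) *
        ∫⁻ z in S ∩ ball 0 1, ENNReal.ofReal (radialDensity α β ‖z‖ * v z) := by
  have hmeas : Measurable fun z : ℂ => ENNReal.ofReal (1 / ProbabilityTheory.beta (α + 1) (β + 1) *
      ‖z‖ ^ (2 * β) * (1 - ‖z‖ ^ 2) ^ α) := by fun_prop
  rw [bergmanMeasure, restrict_withDensity hS, Measure.restrict_restrict hS, normalizedArea,
    Measure.restrict_smul, lintegral_withDensity_eq_lintegral_mul_non_measurable _ hmeas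
      (ae_of_all _ fun z => ENNReal.ofReal_lt_top), lintegral_smul_measure, smul_eq_mul]
  congr 1
  refine setLIntegral_congr_fun (hS.inter measurableSet_ball) fun z hz => ?_
  have hz1 : ‖z‖ < 1 := by simpa using hz.2
  rw [ENNReal.ofReal_mul (radialDensity_nonneg hα hβ (norm_nonneg z) hz1.le)]
  rfl

theorem lintegral_norm_rpow_lt_top {α β p : ℝ} (hp : 0 < p) {f : ℂ → ℂ}
    (hf : MemLp f (ENNReal.ofReal p) (bergmanMeasure α β)) :
    ∫⁻ z, ENNReal.ofReal (‖f z‖ ^ p) ∂bergmanMeasure α β < ⊤ := by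
  have h := lintegral_rpow_enorm_lt_top_of_eLpNorm_lt_top (by simpa using hp)
    ENNReal.ofReal_ne_top hf.2
  rw [ENNReal.toReal_ofReal hp.le] at h
  simpa [← ofReal_norm, ENNReal.ofReal_rpow_of_nonneg, hp.le] using h

theorem ofReal_bergmanNorm_rpow {α β p : ℝ} (hp : 0 < p) {f : ℂ → ℂ}
    (hf : MemLp f (ENNReal.ofReal p) (bergmanMeasure α β)) :
    ENNReal.ofReal (bergmanNorm α β p f ^ p) =
      ∫⁻ z, ENNReal.ofReal (‖f z‖ ^ p) ∂bergmanMeasure α β := by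
  have hint := hf.integrable_norm_rpow (by simpa using hp) ENNReal.ofReal_ne_top
  rw [ENNReal.toReal_ofReal hp.le] at hint
  have hnn : 0 ≤ ∫ z, ‖f z‖ ^ p ∂bergmanMeasure α β := integral_nonneg fun z => by positivity
  rw [bergmanNorm, ← Real.rpow_mul hnn, one_div_mul_cancel hp.ne', Real.rpow_one,
    ofReal_integral_eq_lintegral_ofReal hint (ae_of_all _ fun z => by positivity)]

/-- The lower bound on `m = maxPoleOrder p β` that makes the singularity of `z ^ m * f z`
removable. -/
theorem le_maxPoleOrder_add_one {p β : ℝ} (hβ : -1 < β) (hp : 0 < p) :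
    2 * (β + 1) ≤ p * (maxPoleOrder p β + 1) := by
  have hpos : 0 < 2 * (β + 1) / p := by
    have : 0 < β + 1 := by linarith
    positivity
  suffices 2 * (β + 1) / p ≤ maxPoleOrder p β + 1 by
    rwa [div_le_iff₀ hp, mul_comm _ p] at this
  unfold maxPoleOrder
  split_ifs with h
  · obtain ⟨n, hn⟩ := h
    -- `n` is positive, so that the truncated difference `n - 1` is the true one.
    have hn0 : 0 < n := by
      rw [hn] at hpos
      exact_mod_cast hpos
    rw [hn, Nat.floor_natCast]
    have : n - 1 + 1 = n := by omega
    exact_mod_cast this.ge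
  · exact (Nat.lt_floor_add_one _).le

/-- On the disc of radius `|z|/2` about `z` the density of the measure is comparable to
`|z|^(2β)`. -/
theorem exists_radialDensity_lower_bound {α β : ℝ} (hα : -1 < α) (hβ : -1 < β) :
    ∃ c > 0, ∀ x r : ℝ, 0 < x → x < 1 / 2 → x / 2 ≤ r → r ≤ 3 * x / 2 →
      c * x ^ (2 * β) ≤ radialDensity α β r := by
  have hB := beta_add_one_pos hα hβ
  -- A power function on an interval is bounded below by its smaller endpoint value.
  have hmono : ∀ (e a b y : ℝ), 0 < a → a ≤ y → y ≤ b → min (a ^ e) (b ^ e) ≤ y ^ e := by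
    intro e a b y ha hay hyb
    rcases le_total 0 e with he | he
    · exact (min_le_left _ _).trans (Real.rpow_le_rpow ha.le hay he)
    · exact (min_le_right _ _).trans
        (Real.rpow_le_rpow_of_nonpos (ha.trans_le hay) hyb he)
  refine ⟨1 / ProbabilityTheory.beta (α + 1) (β + 1) *
    min ((1 / 2 : ℝ) ^ (2 * β)) ((3 / 2 : ℝ) ^ (2 * β)) *
    min ((7 / 16 : ℝ) ^ α) ((1 : ℝ) ^ α), by positivity, fun x r hx hx2 h1 h2 => ?_⟩
  have hr : 0 < r := by linarith
  have e1 := hmono (2 * β) (1 / 2) (3 / 2) (r / x) (by norm_num)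
    (by rw [le_div_iff₀ hx]; linarith) (by rw [div_le_iff₀ hx]; linarith)
  have e2 := hmono α (7 / 16) 1 (1 - r ^ 2) (by norm_num) (by nlinarith) (by nlinarith)
  rw [Real.div_rpow hr.le hx.le, le_div_iff₀ (by positivity)] at e1
  unfold radialDensity
  set m1 := min ((1 / 2 : ℝ) ^ (2 * β)) ((3 / 2 : ℝ) ^ (2 * β))
  set m2 := min ((7 / 16 : ℝ) ^ α) ((1 : ℝ) ^ α)
  have hm2 : 0 < m2 := by positivity
  calc _ = 1 / ProbabilityTheory.beta (α + 1) (β + 1) * (m1 * x ^ (2 * β)) * m2 := by ring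
    _ ≤ _ := by gcongr

/-- The mass of `|f|^p` near the origin tends to zero, because the measure has no atom there. -/
theorem tendsto_setLIntegral_closedBall_bergmanMeasure {α β p : ℝ} (hp : 0 < p)
    {f : ℂ → ℂ} (hf : MemLp f (ENNReal.ofReal p) (bergmanMeasure α β)) :
    Tendsto (fun r : ℝ => ∫⁻ z in closedBall 0 r, ENNReal.ofReal (‖f z‖ ^ p) ∂bergmanMeasure α β)
      (𝓝[>] 0) (𝓝 0) := by
  set ν := (bergmanMeasure α β).withDensity fun z => ENNReal.ofReal (‖f z‖ ^ p)
  have hν : ∀ r : ℝ, ν (closedBall 0 r) =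
      ∫⁻ z in closedBall 0 r, ENNReal.ofReal (‖f z‖ ^ p) ∂bergmanMeasure α β := fun r =>
    withDensity_apply _ measurableSet_closedBall
  simp_rw [← hν]
  have hinter : ⋂ r > (0 : ℝ), closedBall (0 : ℂ) r = {0} := by
    ext z
    simp only [mem_iInter, mem_closedBall, dist_zero_right, mem_singleton_iff]
    refine ⟨fun h => ?_, fun h r hr => by simp [h, le_of_lt hr]⟩
    exact norm_le_zero_iff.1 (le_of_forall_gt_imp_ge_of_dense fun r hr => h r hr)
  have hac : ν ≪ volume := by
    refine (withDensity_absolutelyContinuous _ _).trans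
      ((withDensity_absolutelyContinuous _ _).trans ?_)
    exact Measure.absolutelyContinuous_of_le Measure.restrict_le_self |>.trans
      Measure.smul_absolutelyContinuous
  have hzero : ν (⋂ r > (0 : ℝ), closedBall (0 : ℂ) r) = 0 := by
    rw [hinter]
    exact hac (measure_singleton 0)
  rw [← hzero]
  refine tendsto_measure_biInter_gt (fun r _ => measurableSet_closedBall.nullMeasurableSet)
    (fun i j _ hij => closedBall_subset_closedBall hij) ⟨1, one_pos, ?_⟩
  rw [hν]
  exact ((setLIntegral_le_lintegral _ _).trans_lt (lintegral_norm_rpow_lt_top hp hf)).ne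

/-- The sub-mean value property on the disc of radius `|z|/2` about `z` bounds the growth of `f`
at the puncture. -/
theorem exists_norm_rpow_le_setLIntegral {α β p : ℝ} (hα : -1 < α) (hβ : -1 < β) (hp : 0 < p)
    {f : ℂ → ℂ} (hf : DifferentiableOn ℂ f puncturedDisc) :
    ∃ c > 0, ∀ z : ℂ, 0 < ‖z‖ → ‖z‖ < 1 / 2 →
      ENNReal.ofReal (c * (‖z‖ ^ (2 * (β + 1)) * ‖f z‖ ^ p)) ≤
        ∫⁻ w in closedBall 0 (3 * ‖z‖ / 2), ENNReal.ofReal (‖f w‖ ^ p) ∂bergmanMeasure α β := by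
  obtain ⟨c, hc, hlow⟩ := exists_radialDensity_lower_bound hα hβ
  refine ⟨c / 4, by positivity, fun z hz0 hz1 => ?_⟩
  have hw : ∀ w ∈ ball z (‖z‖ / 2), ‖z‖ / 2 ≤ ‖w‖ ∧ ‖w‖ ≤ 3 * ‖z‖ / 2 := by
    intro w hw
    rw [mem_ball, dist_eq_norm] at hw
    have h1 := norm_sub_norm_le w z
    have h2 := norm_sub_norm_le z w
    rw [norm_sub_rev] at h2
    constructor <;> linarith
  have hsub : ball z (‖z‖ / 2) ⊆ puncturedDisc := by
    intro w hwz
    have := hw w hwz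
    refine ⟨by simpa using by linarith, fun h0 => ?_⟩
    rw [mem_singleton_iff.1 h0, norm_zero] at this
    linarith
  have hsub' : ball z (‖z‖ / 2) ⊆ closedBall 0 (3 * ‖z‖ / 2) ∩ ball 0 1 := fun w hwz =>
    ⟨by simpa using (hw w hwz).2, (hsub hwz).1⟩
  have hmean := ofReal_mul_norm_rpow_le_setLIntegral_ball (half_pos hz0) (hf.mono hsub) hp
  rw [setLIntegral_bergmanMeasure hα hβ measurableSet_closedBall]
  calc ENNReal.ofReal (c / 4 * (‖z‖ ^ (2 * (β + 1)) * ‖f z‖ ^ p))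
      = ENNReal.ofReal (1 / Real.pi) * (ENNReal.ofReal (c * ‖z‖ ^ (2 * β)) *
          ENNReal.ofReal (Real.pi * (‖z‖ / 2) ^ 2 * ‖f z‖ ^ p)) := by
        rw [← ENNReal.ofReal_mul (by positivity), ← ENNReal.ofReal_mul (by positivity)]
        congr 1
        rw [show 2 * (β + 1) = 2 * β + (2 : ℕ) by push_cast; ring, Real.rpow_add_natCast hz0.ne']
        have := Real.pi_pos.ne'
        field_simp
        ring
    _ ≤ ENNReal.ofReal (1 / Real.pi) * (ENNReal.ofReal (c * ‖z‖ ^ (2 * β)) *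
          ∫⁻ w in ball z (‖z‖ / 2), ENNReal.ofReal (‖f w‖ ^ p)) := by gcongr
    _ = ENNReal.ofReal (1 / Real.pi) * ∫⁻ w in ball z (‖z‖ / 2),
          ENNReal.ofReal (c * ‖z‖ ^ (2 * β)) * ENNReal.ofReal (‖f w‖ ^ p) := by
        rw [lintegral_const_mul' _ _ ENNReal.ofReal_ne_top]
    _ ≤ ENNReal.ofReal (1 / Real.pi) * ∫⁻ w in ball z (‖z‖ / 2),
          ENNReal.ofReal (radialDensity α β ‖w‖ * ‖f w‖ ^ p) := by
        gcongr ENNReal.ofReal (1 / Real.pi) * ?_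
        refine setLIntegral_mono' measurableSet_ball fun w hwz => ?_
        rw [← ENNReal.ofReal_mul (by positivity)]
        gcongr
        exact hlow _ _ hz0 hz1 (hw w hwz).1 (hw w hwz).2
    _ ≤ _ := by gcongr

/-- Multiplication by `z ^ m` with `m = maxPoleOrder p β` removes the singularity of a function
in the Bergman space at the puncture. -/
theorem exists_differentiableOn_eq_pow_mul {α β p : ℝ} (hα : -1 < α) (hβ : -1 < β) (hp : 0 < p)
    {f : ℂ → ℂ} (hf : f ∈ bergmanSpace α β p) :
    ∃ g : ℂ → ℂ, Measurable g ∧ DifferentiableOn ℂ g (ball 0 1) ∧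
      ∀ z ∈ puncturedDisc, g z = z ^ maxPoleOrder p β * f z := by
  set m := maxPoleOrder p β
  set k : ℂ → ℂ := fun z => z ^ m * f z
  -- The growth bound gives `|z|^(2(β+1)) |f(z)|^p → 0`, hence `|z|^(m+1) |f(z)| → 0`.
  obtain ⟨c, hc, hbound⟩ := exists_norm_rpow_le_setLIntegral hα hβ hp hf.1
  have hev : ∀ᶠ z : ℂ in 𝓝[≠] 0, 0 < ‖z‖ ∧ ‖z‖ < 1 / 2 := by
    have h1 : ∀ᶠ z : ℂ in 𝓝[≠] 0, ‖z‖ < 1 / 2 := by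
      refine eventually_nhdsWithin_of_eventually_nhds ?_
      filter_upwards [ball_mem_nhds (0 : ℂ) (by norm_num : (0 : ℝ) < 1 / 2)] with z hz
      simpa using hz
    filter_upwards [h1, self_mem_nhdsWithin] with z hz hz0
    exact ⟨norm_pos_iff.2 hz0, hz⟩
  have hnorm : Tendsto (fun z : ℂ => 3 * ‖z‖ / 2) (𝓝[≠] 0) (𝓝[>] 0) := by
    refine tendsto_nhdsWithin_iff.2 ⟨?_, ?_⟩
    · have : Continuous fun z : ℂ => 3 * ‖z‖ / 2 := by fun_prop
      simpa using (this.tendsto 0).mono_left nhdsWithin_le_nhds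
    · filter_upwards [hev] with z hz
      have := hz.1
      simp only [mem_Ioi]
      positivity
  have hlim : Tendsto (fun z : ℂ => ‖z‖ ^ (2 * (β + 1)) * ‖f z‖ ^ p) (𝓝[≠] 0) (𝓝 0) := by
    have h1 := (tendsto_setLIntegral_closedBall_bergmanMeasure hp hf.2).comp hnorm
    have h2 : Tendsto (fun z : ℂ => ENNReal.ofReal (c * (‖z‖ ^ (2 * (β + 1)) * ‖f z‖ ^ p)))
        (𝓝[≠] 0) (𝓝 0) :=
      tendsto_of_tendsto_of_tendsto_of_le_of_le' tendsto_const_nhds h1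
        (Eventually.of_forall fun _ => zero_le) (hev.mono fun z hz => hbound z hz.1 hz.2)
    have h3 := (ENNReal.tendsto_toReal ENNReal.zero_ne_top).comp h2
    have h4 := h3.const_mul c⁻¹
    simp only [ENNReal.toReal_zero, mul_zero] at h4
    refine h4.congr fun z => ?_
    rw [Function.comp_apply, ENNReal.toReal_ofReal (by positivity), inv_mul_cancel_left₀ hc.ne']
  have hlim' : Tendsto (fun z : ℂ => ‖z‖ ^ (m + 1) * ‖f z‖) (𝓝[≠] 0) (𝓝 0) := by
    have h1 : Tendsto (fun z : ℂ => (‖z‖ ^ (m + 1) * ‖f z‖) ^ p) (𝓝[≠] 0) (𝓝 0) := by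
      refine tendsto_of_tendsto_of_tendsto_of_le_of_le' tendsto_const_nhds hlim
        (Eventually.of_forall fun _ => by positivity) ?_
      filter_upwards [hev] with z hz
      rw [Real.mul_rpow (by positivity) (norm_nonneg _), ← Real.rpow_natCast, ← Real.rpow_mul
        (norm_nonneg _)]
      refine mul_le_mul_of_nonneg_right ?_ (by positivity)
      refine Real.rpow_le_rpow_of_exponent_ge hz.1 (by linarith [hz.2]) ?_
      have := le_maxPoleOrder_add_one hβ hp
      push_cast
      linarith
    have h2 := h1.rpow_const (p := p⁻¹) (Or.inr (by positivity))
    rw [Real.zero_rpow (by positivity)] at h2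
    refine h2.congr fun z => ?_
    rw [Real.rpow_rpow_inv (by positivity) hp.ne']
  have hlittle : (fun z => k z - k 0) =o[𝓝[≠] 0] fun z => (z - 0)⁻¹ := by
    have hk : k =o[𝓝[≠] 0] fun z => (z - 0)⁻¹ := by
      refine (Asymptotics.isLittleO_iff_tendsto' ?_).2 ?_
      · filter_upwards [self_mem_nhdsWithin] with z hz h
        simp at h
        exact absurd h hz
      · refine tendsto_zero_iff_norm_tendsto_zero.2 (hlim'.congr fun z => ?_)
        simp [k]
        ring
    refine hk.sub ?_
    exact (Asymptotics.isBigO_const_const (k 0) (one_ne_zero : (1 : ℂ) ≠ 0) _).trans_isLittleO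
      (by
        refine (Asymptotics.isLittleO_iff_tendsto' ?_).2 ?_
        · filter_upwards [self_mem_nhdsWithin] with z hz h
          simp at h
          exact absurd h hz
        · simp only [sub_zero, one_div, inv_inv]
          exact tendsto_id.mono_left nhdsWithin_le_nhds)
  have hdiff : DifferentiableOn ℂ k (ball 0 1 \ {0}) :=
    ((differentiable_id.pow m).differentiableOn).mul hf.1
  -- The extension is set to zero off the disc to make it measurable on the whole plane.
  classical
  set g₀ := Function.update k 0 (limUnder (𝓝[≠] 0) k)
  have hg₀ : DifferentiableOn ℂ g₀ (ball 0 1) :=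
    differentiableOn_update_limUnder_of_isLittleO (ball_mem_nhds 0 one_pos) hdiff hlittle
  refine ⟨(ball 0 1).piecewise g₀ 0, ?_, hg₀.congr fun z hz => piecewise_eq_of_mem _ _ _ hz,
    fun z hz => ?_⟩
  · exact hg₀.continuousOn.measurable_piecewise continuousOn_const measurableSet_ball
  · rw [piecewise_eq_of_mem _ _ _ hz.1]
    exact Function.update_of_ne hz.2 _ _

/-! ### The weighted inequality -/

/-- The circular mean `∫ |f(r e^{iθ})|^p dθ`, as a lower integral. -/
noncomputable def circleLIntegral (p : ℝ) (f : ℂ → ℂ) (r : ℝ) : ENNReal :=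
  ∫⁻ θ in Ioo (-Real.pi) Real.pi, ENNReal.ofReal (‖f (circleMap 0 r θ)‖ ^ p)

theorem lintegral_bergmanMeasure_eq_polar {α β p : ℝ} (hα : -1 < α) (hβ : -1 < β) (hp : 0 < p)
    {f : ℂ → ℂ} (hf : DifferentiableOn ℂ f puncturedDisc) :
    ∫⁻ z, ENNReal.ofReal (‖f z‖ ^ p) ∂bergmanMeasure α β =
      ENNReal.ofReal (1 / Real.pi) * ∫⁻ r in Ioo (0 : ℝ) 1,
        ENNReal.ofReal (r * radialDensity α β r) * circleLIntegral p f r := by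
  rw [← setLIntegral_univ, setLIntegral_bergmanMeasure hα hβ MeasurableSet.univ, univ_inter,
    setLIntegral_ball_eq_polar]
  · congr 1
    refine setLIntegral_congr_fun measurableSet_Ioo fun r hr => ?_
    have hd := radialDensity_nonneg hα hβ hr.1.le hr.2.le
    simp only [norm_circleMap_zero, abs_of_pos hr.1, ENNReal.ofReal_mul hd,
      ENNReal.ofReal_mul hr.1.le]
    rw [lintegral_const_mul' _ _ ENNReal.ofReal_ne_top, mul_assoc, circleLIntegral]
  · refine ContinuousOn.mul ?_ (hf.continuousOn.norm.rpow_const fun _ _ => Or.inr hp.le)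
    unfold radialDensity
    refine (continuousOn_const.mul (continuous_norm.continuousOn.rpow_const fun z hz => ?_)).mul
      (ContinuousOn.rpow_const (by fun_prop) fun z hz => ?_)
    · exact Or.inl (norm_ne_zero_iff.2 hz.2)
    · have : ‖z‖ < 1 := by simpa using hz.1
      left
      nlinarith [norm_nonneg z]

/-- The integrand in the definition of `radialWeight`, with its constant. -/
noncomputable def radialKernel (α β p s : ℝ) : ℝ :=
  2 / ProbabilityTheory.beta (α + 1) (β + 1) *
    (s ^ (2 * β - p * maxPoleOrder p β + 1) * (1 - s ^ 2) ^ α)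

theorem radialKernel_nonneg {α β : ℝ} (hα : -1 < α) (hβ : -1 < β) (p : ℝ) {s : ℝ} (h0 : 0 ≤ s)
    (h1 : s ≤ 1) : 0 ≤ radialKernel α β p s := by
  have := beta_add_one_pos hα hβ
  have h2 : 0 ≤ 1 - s ^ 2 := by nlinarith
  unfold radialKernel
  positivity

theorem measurable_radialKernel (α β p : ℝ) : Measurable (radialKernel α β p) := by
  unfold radialKernel
  fun_prop

theorem radialWeight_eq (α β p r : ℝ) :
    radialWeight α β p r =
      r ^ (p * maxPoleOrder p β) * ∫ s in r..1, radialKernel α β p s := by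
  unfold radialWeight radialKernel
  rw [intervalIntegral.integral_const_mul]
  ring

theorem radialWeight_nonneg {α β : ℝ} (hα : -1 < α) (hβ : -1 < β) (p : ℝ) {r : ℝ} (h0 : 0 ≤ r)
    (h1 : r ≤ 1) : 0 ≤ radialWeight α β p r := by
  rw [radialWeight_eq]
  refine mul_nonneg (by positivity) (intervalIntegral.integral_nonneg h1 fun s hs => ?_)
  exact radialKernel_nonneg hα hβ p (h0.trans hs.1) hs.2

/-- Measurability of the weight on `(-1, 1)`, as an integral depending on a parameter. -/
theorem exists_measurable_eqOn_radialWeight_abs (α β p : ℝ) :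
    ∃ w : ℝ → ℝ, Measurable w ∧ EqOn w (fun t => radialWeight α β p |t|) (Ioo (-1) 1) := by
  refine ⟨fun t => |t| ^ (p * maxPoleOrder p β) *
    ∫ s, {x : ℝ × ℝ | |x.1| < x.2 ∧ x.2 ≤ 1}.indicator (fun x => radialKernel α β p x.2) (t, s),
    ?_, fun t ht => ?_⟩
  · refine Measurable.mul (by fun_prop) (StronglyMeasurable.measurable ?_)
    refine StronglyMeasurable.integral_prod_right (Measurable.stronglyMeasurable ?_)
    refine Measurable.indicator ((measurable_radialKernel α β p).comp measurable_snd) ?_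
    exact (measurableSet_lt (by fun_prop) measurable_snd).inter
      (measurableSet_le measurable_snd measurable_const)
  · simp only
    rw [radialWeight_eq, intervalIntegral.integral_of_le (abs_lt.2 ht).le,
      ← integral_indicator measurableSet_Ioc]
    rfl

/-- The weight is the superposition of the intervals `(-s, s)` on which the unweighted
inequality is applied. -/
theorem ofReal_mul_radialWeight_le {α β p : ℝ} (hα : -1 < α) (hβ : -1 < β) {f g : ℂ → ℂ}
    (hgf : ∀ z ∈ puncturedDisc, g z = z ^ maxPoleOrder p β * f z) {ξ : ℂ} (hξ : ‖ξ‖ = 1) {t : ℝ}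
    (ht : t ∈ Ioo (-1 : ℝ) 1) (ht0 : t ≠ 0) :
    ENNReal.ofReal (‖f (t * ξ)‖ ^ p * radialWeight α β p |t|) ≤
      ∫⁻ s in Ioo (0 : ℝ) 1, {x : ℝ × ℝ | |x.1| < x.2}.indicator (fun x =>
        ENNReal.ofReal (‖g (x.1 * ξ)‖ ^ p) * ENNReal.ofReal (radialKernel α β p x.2)) (t, s) := by
  have hξ0 : ξ ≠ 0 := by
    rintro rfl
    simp at hξ
  have ht1 : |t| < 1 := abs_lt.2 ht
  have hmem : (t : ℂ) * ξ ∈ puncturedDisc := by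
    refine ⟨by simpa [hξ] using ht1, ?_⟩
    simp [ht0, hξ0]
  have hnorm : ‖g (t * ξ)‖ ^ p = |t| ^ (p * maxPoleOrder p β) * ‖f (t * ξ)‖ ^ p := by
    rw [hgf _ hmem, norm_mul, norm_pow, norm_mul, hξ, mul_one, Complex.norm_real, Real.norm_eq_abs,
      Real.mul_rpow (by positivity) (norm_nonneg _), ← Real.rpow_natCast, ← Real.rpow_mul
      (abs_nonneg t), mul_comm (p : ℝ)]
  have hind : ∀ s, {x : ℝ × ℝ | |x.1| < x.2}.indicator (fun x : ℝ × ℝ =>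
        ENNReal.ofReal (‖g (x.1 * ξ)‖ ^ p) * ENNReal.ofReal (radialKernel α β p x.2)) (t, s) =
      (Ioi |t|).indicator (fun s => ENNReal.ofReal (‖g (t * ξ)‖ ^ p) *
        ENNReal.ofReal (radialKernel α β p s)) s := fun s => rfl
  simp_rw [hind]
  rw [setLIntegral_indicator measurableSet_Ioi, lintegral_const_mul' _ _ ENNReal.ofReal_ne_top]
  have hset : Ioi |t| ∩ Ioo 0 1 = Ioo |t| 1 := by
    ext s
    simp only [mem_inter_iff, mem_Ioi, mem_Ioo]
    exact ⟨fun h => ⟨h.1, h.2.2⟩, fun h => ⟨h.1, (abs_nonneg t).trans_lt h.1, h.2⟩⟩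
  rw [hset, radialWeight_eq, ← mul_assoc, mul_comm (‖f (t * ξ)‖ ^ p), ← hnorm,
    ENNReal.ofReal_mul (by positivity)]
  gcongr
  rw [intervalIntegral.integral_of_le ht1.le, integral_Ioc_eq_integral_Ioo,
    integral_eq_lintegral_of_nonneg_ae]
  · exact ENNReal.ofReal_toReal_le
  · filter_upwards [ae_restrict_mem measurableSet_Ioo] with s hs
    exact radialKernel_nonneg hα hβ p ((abs_nonneg t).trans hs.1.le) hs.2.le
  · exact (measurable_radialKernel α β p).aestronglyMeasurable

theorem setLIntegral_circle_pow_mul {p : ℝ} {m : ℕ} {f g : ℂ → ℂ}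
    (hgf : ∀ z ∈ puncturedDisc, g z = z ^ m * f z) {r : ℝ} (h0 : 0 < r) (h1 : r < 1) :
    ∫⁻ θ in Ioo (-Real.pi) Real.pi, ENNReal.ofReal (‖g (circleMap 0 r θ)‖ ^ p) =
      ENNReal.ofReal (r ^ (p * m)) * circleLIntegral p f r := by
  rw [circleLIntegral, ← lintegral_const_mul' _ _ ENNReal.ofReal_ne_top]
  congr 1
  ext θ
  have hmem : circleMap 0 r θ ∈ puncturedDisc :=
    ⟨by simpa [abs_of_pos h0] using h1, by simp [h0.ne']⟩
  rw [hgf _ hmem, norm_mul, norm_pow, norm_circleMap_zero, abs_of_pos h0,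
    Real.mul_rpow (by positivity) (norm_nonneg _), ← Real.rpow_natCast, ← Real.rpow_mul h0.le,
    mul_comm (p : ℝ), ENNReal.ofReal_mul (by positivity)]

/-- The weighted inequality for lower integrals: Tonelli's theorem, the unweighted inequality on
almost every circle, and the estimate `r ≤ 1`. -/
theorem setLIntegral_mul_radialWeight_le {α β p : ℝ} (hα : -1 < α) (hβ : -1 < β) (hp : 0 < p)
    {f g : ℂ → ℂ} (hf : DifferentiableOn ℂ f puncturedDisc) (hgm : Measurable g)
    (hg : DifferentiableOn ℂ g (ball 0 1))
    (hgf : ∀ z ∈ puncturedDisc, g z = z ^ maxPoleOrder p β * f z) {ξ : ℂ} (hξ : ‖ξ‖ = 1) :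
    ∫⁻ t in Ioo (-1 : ℝ) 1, ENNReal.ofReal (‖f (t * ξ)‖ ^ p * radialWeight α β p |t|) ≤
      ENNReal.ofReal Real.pi * ∫⁻ z, ENNReal.ofReal (‖f z‖ ^ p) ∂bergmanMeasure α β := by
  set K : ℝ × ℝ → ENNReal := {x : ℝ × ℝ | |x.1| < x.2}.indicator fun x =>
    ENNReal.ofReal (‖g (x.1 * ξ)‖ ^ p) * ENNReal.ofReal (radialKernel α β p x.2)
  have hK : Measurable K := by
    refine Measurable.indicator (Measurable.fun_mul ?_ ?_)
      (measurableSet_lt (by fun_prop) measurable_snd)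
    · refine ENNReal.measurable_ofReal.comp ((hgm.comp ?_).norm.pow_const p)
      fun_prop
    · exact ENNReal.measurable_ofReal.comp ((measurable_radialKernel α β p).comp measurable_snd)
  have hslice : ∀ s ∈ Ioo (0 : ℝ) 1, ∫⁻ t in Ioo (-1 : ℝ) 1, K (t, s) =
      ENNReal.ofReal (radialKernel α β p s) *
        ∫⁻ t in Ioo (-s) s, ENNReal.ofReal (‖g (t * ξ)‖ ^ p) := by
    intro s hs
    have hind : ∀ t, K (t, s) = (Ioo (-s) s).indicator (fun t : ℝ =>
        ENNReal.ofReal (‖g (t * ξ)‖ ^ p) * ENNReal.ofReal (radialKernel α β p s)) t := by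
      intro t
      simp only [K, indicator_apply, mem_ofPred_eq, abs_lt, mem_Ioo]
    simp_rw [hind]
    rw [setLIntegral_indicator measurableSet_Ioo,
      inter_eq_left.2 (Ioo_subset_Ioo (by linarith [hs.2]) hs.2.le),
      lintegral_mul_const' _ _ ENNReal.ofReal_ne_top, mul_comm]
  calc ∫⁻ t in Ioo (-1 : ℝ) 1, ENNReal.ofReal (‖f (t * ξ)‖ ^ p * radialWeight α β p |t|)
      ≤ ∫⁻ t in Ioo (-1 : ℝ) 1, ∫⁻ s in Ioo (0 : ℝ) 1, K (t, s) := by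
        refine lintegral_mono_ae ?_
        filter_upwards [ae_restrict_mem measurableSet_Ioo,
          ae_restrict_of_ae (Measure.ae_ne volume (0 : ℝ))] with t ht ht0
        exact ofReal_mul_radialWeight_le hα hβ hgf hξ ht ht0
    _ = ∫⁻ s in Ioo (0 : ℝ) 1, ∫⁻ t in Ioo (-1 : ℝ) 1, K (t, s) :=
        lintegral_lintegral_swap (f := fun t s => K (t, s)) hK.aemeasurable
    _ ≤ ∫⁻ s in Ioo (0 : ℝ) 1,
          ENNReal.ofReal (s * radialDensity α β s) * circleLIntegral p f s := by
        refine lintegral_mono_ae ?_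
        filter_upwards [ae_restrict_mem measurableSet_Ioo,
          ae_restrict_of_ae (ae_setLIntegral_diameter_le hg hp hξ)] with s hs hFR
        rw [hslice s hs]
        have h := hFR hs.1 hs.2
        rw [setLIntegral_circle_pow_mul hgf hs.1 hs.2] at h
        have hV := radialKernel_nonneg hα hβ p hs.1.le hs.2.le
        have hd := radialDensity_nonneg hα hβ hs.1.le hs.2.le
        have hprod : radialKernel α β p s * (s / 2 * s ^ (p * maxPoleOrder p β)) =
            s * (s * radialDensity α β s) := by
          have hpow : s ^ (2 * β - p * maxPoleOrder p β + 1) * s ^ (p * maxPoleOrder p β) =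
              s ^ (2 * β) * s := by
            rw [← Real.rpow_add hs.1, ← Real.rpow_add_one hs.1.ne']
            congr 1
            ring
          -- The powers of `s` on both sides combine to `s ^ (2β + 2)`.
          unfold radialKernel radialDensity
          linear_combination (s * (1 - s ^ 2) ^ α / ProbabilityTheory.beta (α + 1) (β + 1)) * hpow
        calc _ ≤ ENNReal.ofReal (radialKernel α β p s) * (ENNReal.ofReal (s / 2) *
              (ENNReal.ofReal (s ^ (p * maxPoleOrder p β)) * circleLIntegral p f s)) := by gcongr
          _ = ENNReal.ofReal (s * (s * radialDensity α β s)) * circleLIntegral p f s := by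
              have hs0 := hs.1
              rw [← hprod, ENNReal.ofReal_mul hV, ENNReal.ofReal_mul (by positivity)]
              ring
          _ ≤ _ := by
              gcongr ENNReal.ofReal ?_ * _
              exact mul_le_of_le_one_left (mul_nonneg hs.1.le hd) hs.2.le
    _ = ENNReal.ofReal Real.pi * ∫⁻ z, ENNReal.ofReal (‖f z‖ ^ p) ∂bergmanMeasure α β := by
        rw [lintegral_bergmanMeasure_eq_polar hα hβ hp hf, ← mul_assoc,
          ← ENNReal.ofReal_mul Real.pi_pos.le, mul_one_div_cancel Real.pi_pos.ne',
          ENNReal.ofReal_one, one_mul]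

end MeromorphicBergman

theorem mainTheorem3 (α β p : ℝ) (hα : -1 < α) (hβ : -1 < β) (hp : 0 < p)
    (f : ℂ → ℂ) (hf : f ∈ bergmanSpace α β p) (ξ : ℂ) (hξ : ‖ξ‖ = 1) :
    IntervalIntegrable (fun t : ℝ => ‖f ((t : ℂ) * ξ)‖ ^ p * radialWeight α β p |t|)
        volume (-1) 1 ∧
      ∫ t in (-1 : ℝ)..1, ‖f ((t : ℂ) * ξ)‖ ^ p * radialWeight α β p |t| ≤
        Real.pi * bergmanNorm α β p f ^ p := by
  obtain ⟨g, hgm, hg, hgf⟩ := exists_differentiableOn_eq_pow_mul hα hβ hp hf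
  obtain ⟨w, hw, hwt⟩ := exists_measurable_eqOn_radialWeight_abs α β p
  have hle := setLIntegral_mul_radialWeight_le hα hβ hp hf.1 hgm hg hgf hξ
  rw [← ofReal_bergmanNorm_rpow hp hf.2, ← ENNReal.ofReal_mul Real.pi_pos.le] at hle
  have hξ0 : ξ ≠ 0 := by
    rintro rfl
    simp at hξ
  have hmeas : AEStronglyMeasurable
      (fun t : ℝ => ‖f ((t : ℂ) * ξ)‖ ^ p * radialWeight α β p |t|)
      (volume.restrict (Set.Ioo (-1) 1)) := by
    have hm : Measurable fun t : ℝ =>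
        ‖g ((t : ℂ) * ξ) / ((t : ℂ) * ξ) ^ maxPoleOrder p β‖ ^ p * w t := by
      refine Measurable.mul (Measurable.pow_const (Measurable.norm (Measurable.div
        (hgm.comp ?_) ?_)) p) hw <;> fun_prop
    refine hm.aestronglyMeasurable.congr ?_
    filter_upwards [ae_restrict_mem measurableSet_Ioo,
      ae_restrict_of_ae (Measure.ae_ne volume (0 : ℝ))] with t ht ht0
    have hz : (t : ℂ) * ξ ≠ 0 := mul_ne_zero (by exact_mod_cast ht0) hξ0
    have hmem : (t : ℂ) * ξ ∈ puncturedDisc := ⟨by simpa [hξ] using abs_lt.2 ht, hz⟩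
    rw [hwt ht, hgf _ hmem, mul_div_cancel_left₀ _ (pow_ne_zero _ hz)]
  have hnn : 0 ≤ᵐ[volume.restrict (Set.Ioo (-1 : ℝ) 1)]
      fun t : ℝ => ‖f ((t : ℂ) * ξ)‖ ^ p * radialWeight α β p |t| := by
    filter_upwards [ae_restrict_mem measurableSet_Ioo] with t ht
    have := radialWeight_nonneg hα hβ p (abs_nonneg t) (abs_lt.2 ht).le
    positivity
  refine ⟨?_, ?_⟩
  · rw [intervalIntegrable_iff_integrableOn_Ioo_of_le (by norm_num)]
    refine ⟨hmeas, ?_⟩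
    rw [hasFiniteIntegral_iff_ofReal hnn]
    exact hle.trans_lt ENNReal.ofReal_lt_top
  · have hnorm : 0 ≤ bergmanNorm α β p f :=
      Real.rpow_nonneg (integral_nonneg fun z => by positivity) _
    rw [intervalIntegral.integral_of_le (by norm_num), integral_Ioc_eq_integral_Ioo,
      integral_eq_lintegral_of_nonneg_ae hnn hmeas]
    refine ENNReal.toReal_le_of_le_ofReal ?_ hle
    have := Real.pi_pos
    positivity
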